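/- Let $n\in\mathbb N$ and $p\in\{0,1,2,\dots\}\cup\{+\infty\}$. Let $D$ be the open unit disc in $\mathbb C$, $D^n\subseteq\mathbb C^n$ the open unit polydisc, and $\mathbb T^n=\{z\in\mathbb C^n: |z_1|=\dots=|z_n|=1\}$ its distinguished boundary. Let $A^p(D^n)$ be the space of holomorphic functions $f:D^n\to\mathbb C$ such that, for every multi-index $\alpha\in\mathbb N^n$ with $|\alpha|\le p$, the partial derivative $\partial^{\alpha}f/\partial z^{\alpha}$ extends continuously to $\overline{D^n}$; the continuous extension of such an $f$ to $\overline{D^n}$ is again denoted by $f$. A holomorphic function $f$ on $D^n$ is called holomorphically extendable at a point $\zeta\in\partial D^n$ if there are an open ball $B$ centered at $\zeta$ and a holomorphic function $F:B\to\mathbb C$ such that $F=f$ on a connected component of $B\cap D^n$. A function $g:\mathbb T^n\to\mathbb C$ is called holomorphically extendable at a point $\zeta\in\mathbb T^n$ if there are an open neighborhood $U\subseteq\mathbb C^n$ of $\zeta$ and a holomorphic function $F:U\to\mathbb C$ such that $F=g$ on $U\cap\mathbb T^n$. Let $f\in A^p(D^n)$ and $\zeta\in\mathbb T^n$. Then $f$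 is holomorphically extendable at $\zeta$ (as a function on $D^n$) if and only if its restriction $f|_{\mathbb T^n}$ is holomorphically extendable at $\zeta$ (as a function on $\mathbb T^n$). -/

import Mathlib

open Set Filter Topology

/-- The space `ℂⁿ` with its Euclidean norm. -/
abbrev Cn (n : ℕ) : Type := EuclideanSpace ℂ (Fin n)

/-- The open unit polydisc `Dⁿ`. -/
def polydisc (n : ℕ) : Set (Cn n) := {z | ∀ i, ‖z i‖ < 1}

/-- The distinguished boundary `𝕋ⁿ` of the polydisc. -/
def torus (n : ℕ) : Set (Cn n) := {z | ∀ i, ‖z i‖ = 1}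

/-- The complex partial derivative `∂f/∂z_j`. -/
noncomputable def partialDeriv {n : ℕ} (j : Fin n) (f : Cn n → ℂ) : Cn n → ℂ :=
  fun z => lineDeriv ℂ f z (EuclideanSpace.single j 1)

/-- The mixed partial derivative `∂^α f / ∂z^α = ∂^|α| f / ∂z₁^α₁ ⋯ ∂zₙ^αₙ`. -/
noncomputable def multiDeriv {n : ℕ} (α : Fin n → ℕ) (f : Cn n → ℂ) : Cn n → ℂ :=
  (List.finRange n).foldr (fun j g => (partialDeriv j)^[α j] g) f

/-- The space `A^p(Ω)`: functions holomorphic on the open set `Ω` all of whose partial derivatives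
of order `|α| ≤ p` extend continuously to the closure of `Ω`. Only the values of `f` on `Ω` matter;
the continuous extension of `f` itself to `closure Ω` is `extendFrom Ω f`. -/
def ApSpace {n : ℕ} (p : ℕ∞) (Ω : Set (Cn n)) : Set (Cn n → ℂ) :=
  {f | DifferentiableOn ℂ f Ω ∧
    ∀ α : Fin n → ℕ, ((∑ i, α i : ℕ) : ℕ∞) ≤ p →
      ∃ g : Cn n → ℂ, ContinuousOn g (closure Ω) ∧ EqOn g (multiDeriv α f) Ω}

/-- `extendFrom Ω f` is indeed the continuous extension, whenever there is one. -/
theorem extendFrom_eqOn_of_continuousOn {n : ℕ} {Ω : Set (Cn n)} {f g : Cn n → ℂ}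
    (hg : ContinuousOn g (closure Ω)) (h : EqOn g f Ω) :
    EqOn (extendFrom Ω f) g (closure Ω) := by
  intro x hx
  refine extendFrom_eq hx ?_
  exact ((hg x hx).mono subset_closure).tendsto.congr' (h.eventuallyEq_nhdsWithin)

/-- Holomorphic extendability of a function `f` on `Ω` at a boundary point `ζ` of `Ω`: on some
open ball `B` centred at `ζ` there is a holomorphic function that agrees with `f` on some
connected component of `B ∩ Ω`. -/
def HolExtendableAt {n : ℕ} (Ω : Set (Cn n)) (f : Cn n → ℂ) (ζ : Cn n) : Prop :=
  ∃ r : ℝ, 0 < r ∧ ∃ F : Cn n → ℂ, DifferentiableOn ℂ F (Metric.ball ζ r) ∧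
    ∃ x ∈ Metric.ball ζ r ∩ Ω, EqOn F f (connectedComponentIn (Metric.ball ζ r ∩ Ω) x)

/-- Holomorphic extendability of a function `f : 𝕋ⁿ → ℂ` at a point `ζ` of `𝕋ⁿ`: on some open
neighbourhood `U` of `ζ` there is a holomorphic function that agrees with `f` on `U ∩ 𝕋ⁿ`. -/
def TorusHolExtendableAt {n : ℕ} (f : torus n → ℂ) (ζ : torus n) : Prop :=
  ∃ U : Set (Cn n), IsOpen U ∧ (ζ : Cn n) ∈ U ∧ ∃ F : Cn n → ℂ, DifferentiableOn ℂ F U ∧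
    ∀ z : torus n, (z : Cn n) ∈ U → F z = f z

/-- The restriction to `𝕋ⁿ` of (the continuous extension to the closed polydisc of) a function `f`
on the polydisc. -/
noncomputable def torusRestrict {n : ℕ} (f : Cn n → ℂ) : torus n → ℂ :=
  fun z => extendFrom (polydisc n) f z

/-! Both conditions concern the continuous extension `g` of `f` to the closed polydisc. If `F`
extends `f` across `ζ`, then `F = g` at nearby torus points by passing to the limit from inside.
Conversely, let `F = g` on the torus near `ζ`. A nearby point of the polydisc is `ζ_j exp(i t_j)`
with `Im t_j > 0`, and it lies on the analytic disc `w ↦ ζ_j exp(i (Re t_j + w Im t_j))` at `w = i`.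
Real `w` land in the torus and `Im w > 0` in the polydisc, so `F - g` pulls back to a function of
one variable vanishing on a real segment. Boundary uniqueness (`eq_zero_of_eq_zero_on_diameter`)
makes it vanish at `i`. -/

lemma isOpen_polydisc (n : ℕ) : IsOpen (polydisc n) := by
  have h : polydisc n = ⋂ i, {z : Cn n | ‖z i‖ < 1} := by ext z; simp [polydisc]
  rw [h]
  exact isOpen_iInter_of_finite fun i => isOpen_lt (by fun_prop) continuous_const

lemma convex_polydisc (n : ℕ) : Convex ℝ (polydisc n) := by
  intro x hx y hy a b ha hb hab i
  have h := convex_ball (0 : ℂ) 1 (mem_ball_zero_iff.2 (hx i)) (mem_ball_zero_iff.2 (hy i))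
    ha hb hab
  simpa using h

lemma mem_closure_polydisc {n : ℕ} {z : Cn n} (hz : ∀ i, ‖z i‖ ≤ 1) :
    z ∈ closure (polydisc n) := by
  have hlim : Tendsto (fun t : ℝ => t • z) (𝓝[<] 1) (𝓝 z) := by
    have : Tendsto (fun t : ℝ => t • z) (𝓝 1) (𝓝 ((1 : ℝ) • z)) :=
      Continuous.tendsto (by fun_prop) 1
    rw [one_smul] at this
    exact this.mono_left nhdsWithin_le_nhds
  refine mem_closure_of_tendsto hlim ?_
  filter_upwards [Ioo_mem_nhdsLT (zero_lt_one (α := ℝ))] with t ht i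
  have : ‖(t • z) i‖ = t * ‖z i‖ := by simp [abs_of_pos ht.1]
  rw [this]
  nlinarith [hz i, ht.1, ht.2, norm_nonneg (z i)]

lemma multiDeriv_zero {n : ℕ} (f : Cn n → ℂ) : multiDeriv 0 f = f := by
  unfold multiDeriv
  induction List.finRange n with
  | nil => rfl
  | cons j l _ => simp

/-- Every function in `A^p(Ω)` has a continuous extension to `closure Ω`. -/
lemma ApSpace.exists_continuousOn {n : ℕ} {p : ℕ∞} {Ω : Set (Cn n)} {f : Cn n → ℂ}
    (hf : f ∈ ApSpace p Ω) : ∃ g : Cn n → ℂ, ContinuousOn g (closure Ω) ∧ EqOn g f Ω := by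
  simpa [multiDeriv_zero] using hf.2 0 (by simp)

/-- The open upper half of the disc of radius `2`. -/
def upperHalfDisc : Set ℂ := {w | 0 < w.im ∧ ‖w‖ < 2}

lemma isOpen_upperHalfDisc : IsOpen upperHalfDisc :=
  (isOpen_lt continuous_const Complex.continuous_im).inter
    (isOpen_lt continuous_norm continuous_const)

lemma closure_upperHalfDisc_subset :
    closure upperHalfDisc ⊆ {w | 0 ≤ w.im ∧ ‖w‖ ≤ 2} :=
  closure_minimal (fun _ hw => ⟨hw.1.le, hw.2.le⟩)
    ((isClosed_le continuous_const Complex.continuous_im).inter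
      (isClosed_le continuous_norm continuous_const))

lemma isBounded_upperHalfDisc : Bornology.IsBounded upperHalfDisc :=
  Metric.isBounded_ball.subset fun _ hw => mem_ball_zero_iff.2 hw.2

/-- A boundary uniqueness theorem: a holomorphic function on the half disc, continuous up to the
boundary, that vanishes on the diameter vanishes at `I`. -/
lemma eq_zero_of_eq_zero_on_diameter {h : ℂ → ℂ} (hd : DiffContOnCl ℂ h upperHalfDisc)
    (h0 : ∀ w ∈ closure upperHalfDisc, w.im = 0 → h w = 0) : h Complex.I = 0 := by
  have hI : Complex.I ∈ closure upperHalfDisc := subset_closure (by simp [upperHalfDisc])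
  obtain ⟨M, hM⟩ := isBounded_upperHalfDisc.isCompact_closure.exists_bound_of_continuousOn
    hd.continuousOn
  have hM0 : 0 ≤ M := (norm_nonneg _).trans (hM _ hI)
  -- With `w = x + iy`, this weight has modulus `e^N` at `I`, while on the arc `|w| = 2` its
  -- exponent is `-2N y (2 - y) ≤ 0`. On the diameter it may be large, but `h` vanishes there. The
  -- maximum principle then gives `e^N |h(I)| ≤ M` for every `N`.
  have hnorm : ∀ (N : ℕ) (w : ℂ), ‖Complex.exp (-N * (w - 2 * Complex.I) ^ 2)‖ =
      Real.exp (N * ((2 - w.im) ^ 2 - w.re ^ 2)) := by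
    intro N w
    rw [Complex.norm_exp]
    congr 1
    simp [pow_two]
    ring
  have key : ∀ N : ℕ, Real.exp N * ‖h Complex.I‖ ≤ M := by
    intro N
    have hdN : DiffContOnCl ℂ (fun w => Complex.exp (-N * (w - 2 * Complex.I) ^ 2) * h w)
        upperHalfDisc := by
      have he : Differentiable ℂ fun w : ℂ => Complex.exp (-N * (w - 2 * Complex.I) ^ 2) := by
        fun_prop
      exact he.diffContOnCl.smul hd
    have := Complex.norm_le_of_forall_mem_frontier_norm_le isBounded_upperHalfDisc hdN (C := M)
      ?_ hI
    · rw [norm_mul, hnorm] at this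
      norm_num at this
      exact this
    · intro w hw
      have hwc := hw.1
      have hwU : w ∉ upperHalfDisc := by
        have := hw.2
        rwa [isOpen_upperHalfDisc.interior_eq] at this
      obtain ⟨h1, h2⟩ := closure_upperHalfDisc_subset hwc
      rcases h1.eq_or_lt with h1 | h1
      · simpa [h0 w hwc h1.symm] using hM0
      · have h2' : ‖w‖ = 2 := le_antisymm h2 (not_lt.1 fun h3 => hwU ⟨h1, h3⟩)
        have hsq : w.re ^ 2 + w.im ^ 2 = 4 := by
          have := Complex.sq_norm w
          rw [h2', Complex.normSq_apply] at this
          linarith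
        have him : w.im ≤ 2 := by nlinarith [sq_nonneg w.re]
        rw [norm_mul, hnorm]
        have : Real.exp (N * ((2 - w.im) ^ 2 - w.re ^ 2)) ≤ 1 := by
          rw [Real.exp_le_one_iff]
          exact mul_nonpos_of_nonneg_of_nonpos (Nat.cast_nonneg N) (by nlinarith)
        calc _ ≤ 1 * M := by gcongr; exact hM w hwc
          _ = M := one_mul M
  by_contra hne
  have hpos : 0 < ‖h Complex.I‖ := norm_pos_iff.2 hne
  obtain ⟨N, hN⟩ := exists_nat_gt (M / ‖h Complex.I‖)
  rw [div_lt_iff₀ hpos] at hN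
  have h1 := key N
  have h2 : (N : ℝ) ≤ Real.exp N := by linarith [Real.add_one_le_exp (N : ℝ)]
  nlinarith

/-- The map `t ↦ (ζ₁ exp(i t₁), …, ζₙ exp(i tₙ))`. -/
noncomputable def torusExp {n : ℕ} (ζ : Cn n) (t : Fin n → ℂ) : Cn n :=
  WithLp.toLp 2 fun i => ζ i * Complex.exp (Complex.I * t i)

lemma differentiable_torusExp {n : ℕ} (ζ : Cn n) : Differentiable ℂ (torusExp ζ) := by
  rw [differentiable_euclidean]
  intro i
  simp only [torusExp]
  fun_prop

lemma torusExp_zero {n : ℕ} (ζ : Cn n) : torusExp ζ 0 = ζ := by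
  ext i
  simp [torusExp]

/-- The signs of the `Im t_i` locate the point: all zero on the torus, all positive inside the
polydisc. -/
lemma norm_torusExp_apply {n : ℕ} (ζ : torus n) (t : Fin n → ℂ) (i : Fin n) :
    ‖torusExp (ζ : Cn n) t i‖ = Real.exp (-(t i).im) := by
  simp [torusExp, ζ.2 i, Complex.norm_exp]

/-- Points near `ζ ∈ 𝕋ⁿ` are of the form `torusExp ζ t` with `t` small. -/
lemma eventually_exists_torusExp_eq {n : ℕ} (ζ : torus n) {ε : ℝ} (hε : 0 < ε) :
    ∀ᶠ a in 𝓝 (ζ : Cn n), ∃ t : Fin n → ℂ, ‖t‖ < ε ∧ torusExp (ζ : Cn n) t = a := by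
  have hne : ∀ i, (ζ : Cn n) i ≠ 0 := fun i => norm_pos_iff.1 (by rw [ζ.2 i]; exact one_pos)
  have hdiv : ∀ i, Tendsto (fun a : Cn n => a i / (ζ : Cn n) i) (𝓝 (ζ : Cn n)) (𝓝 1) := by
    intro i
    have : Tendsto (fun a : Cn n => a i / (ζ : Cn n) i) (𝓝 (ζ : Cn n))
        (𝓝 ((ζ : Cn n) i / (ζ : Cn n) i)) := Continuous.tendsto (by fun_prop) _
    rwa [div_self (hne i)] at this
  -- The principal logarithm is continuous at `1`, so it inverts `torusExp` near `ζ`.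
  have hlog : Tendsto (fun (a : Cn n) i => -Complex.I * Complex.log (a i / (ζ : Cn n) i))
      (𝓝 (ζ : Cn n)) (𝓝 0) := by
    rw [tendsto_pi_nhds]
    intro i
    have := ((hdiv i).clog (by simp)).const_mul (-Complex.I)
    simpa using this
  have hsmall : ∀ᶠ a in 𝓝 (ζ : Cn n),
      ‖fun i => -Complex.I * Complex.log (a i / (ζ : Cn n) i)‖ < ε :=
    hlog.norm.eventually_lt_const (by simpa using hε)
  have hnz : ∀ᶠ a in 𝓝 (ζ : Cn n), ∀ i, a i / (ζ : Cn n) i ≠ 0 :=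
    eventually_all.2 fun i => (hdiv i).eventually_ne one_ne_zero
  filter_upwards [hsmall, hnz] with a ha hnz
  refine ⟨_, ha, ?_⟩
  ext i
  have : Complex.I * (-Complex.I * Complex.log (a i / (ζ : Cn n) i)) =
      Complex.log (a i / (ζ : Cn n) i) := by
    rw [← mul_assoc]; simp
  simp only [torusExp, this, Complex.exp_log (hnz i)]
  field_simp [hne i]

/-- Local uniqueness: if `g` is continuous on the closed polydisc, holomorphic inside, and agrees
on `U ∩ 𝕋ⁿ` with a function `F` holomorphic on the open set `U`, then `g = F` at all points of the
polydisc close to a given point of `U ∩ 𝕋ⁿ`. -/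
lemma eventually_eq_of_eq_on_torus {n : ℕ} {g F : Cn n → ℂ} {U : Set (Cn n)} (hU : IsOpen U)
    (hgc : ContinuousOn g (closure (polydisc n))) (hgd : DifferentiableOn ℂ g (polydisc n))
    (hF : DifferentiableOn ℂ F U) (h : ∀ z ∈ U ∩ torus n, F z = g z) (ζ : torus n)
    (hζ : (ζ : Cn n) ∈ U) :
    ∀ᶠ a in 𝓝 (ζ : Cn n), a ∈ polydisc n → F a = g a := by
  obtain ⟨ε, hε, hεU⟩ : ∃ ε > 0, ∀ t : Fin n → ℂ, ‖t‖ < ε → torusExp (ζ : Cn n) t ∈ U := by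
    have : ∀ᶠ t in 𝓝 (0 : Fin n → ℂ), torusExp (ζ : Cn n) t ∈ U :=
      (differentiable_torusExp (ζ : Cn n)).continuous.continuousAt.eventually_mem
        (by rw [torusExp_zero]; exact hU.mem_nhds hζ)
    simpa using Metric.eventually_nhds_iff_ball.1 this
  -- The factor 3 absorbs `‖c w‖ ≤ 3 ‖t‖` for `‖w‖ ≤ 2`.
  filter_upwards [eventually_exists_torusExp_eq ζ (ε := ε / 3) (by positivity)]
  rintro _ ⟨t, ht, rfl⟩ hmem
  have him : ∀ i, 0 < (t i).im := fun i => by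
    have := hmem i
    rw [norm_torusExp_apply] at this
    simpa using this
  -- The affine line through `Re t` (at `w = 0`) and `t` (at `w = I`), real for real `w`.
  set c : ℂ → Fin n → ℂ := fun w i => (t i).re + (t i).im * w with hc
  have hcd : Differentiable ℂ fun w => torusExp (ζ : Cn n) (c w) :=
    (differentiable_torusExp _).comp (by simp only [hc]; fun_prop)
  have hcim : ∀ w i, (c w i).im = (t i).im * w.im := by simp [hc]
  have hcU : ∀ w : ℂ, ‖w‖ ≤ 2 → torusExp (ζ : Cn n) (c w) ∈ U := by
    intro w hw
    refine hεU _ (lt_of_le_of_lt ((pi_norm_le_iff_of_nonneg (by positivity)).2 ?_)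
      (show 3 * ‖t‖ < ε by linarith))
    intro i
    have h1 : |(t i).re| ≤ ‖t‖ := (Complex.abs_re_le_norm _).trans (norm_le_pi_norm t i)
    have h2 : |(t i).im| ≤ ‖t‖ := (Complex.abs_im_le_norm _).trans (norm_le_pi_norm t i)
    calc ‖c w i‖ ≤ |(t i).re| + |(t i).im| * ‖w‖ := by
          refine (norm_add_le _ _).trans ?_
          simp
      _ ≤ ‖t‖ + ‖t‖ * 2 := by gcongr
      _ = 3 * ‖t‖ := by ring
  have hcP : ∀ w ∈ upperHalfDisc, torusExp (ζ : Cn n) (c w) ∈ polydisc n := by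
    intro w hw i
    rw [norm_torusExp_apply, hcim]
    simpa using mul_pos (him i) hw.1
  have hcC : MapsTo (fun w => torusExp (ζ : Cn n) (c w)) (closure upperHalfDisc)
      (closure (polydisc n)) := by
    intro w hw
    refine mem_closure_polydisc fun i => ?_
    rw [norm_torusExp_apply, hcim]
    simpa using mul_nonneg (him i).le (closure_upperHalfDisc_subset hw).1
  have hzero := eq_zero_of_eq_zero_on_diameter
    (h := fun w => F (torusExp (ζ : Cn n) (c w)) - g (torusExp (ζ : Cn n) (c w))) ?_ ?_
  · have hcI : c Complex.I = t := funext fun i => Complex.re_add_im (t i)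
    simpa [hcI, sub_eq_zero] using hzero
  · refine ⟨?_, ?_⟩
    · exact (hF.comp hcd.differentiableOn fun w hw => hcU w hw.2.le).sub
        (hgd.comp hcd.differentiableOn hcP)
    · exact (hF.continuousOn.comp hcd.continuous.continuousOn
        fun w hw => hcU w (closure_upperHalfDisc_subset hw).2).sub
        (hgc.comp hcd.continuous.continuousOn hcC)
  · intro w hw hw0
    refine sub_eq_zero.2 (h _ ⟨hcU w (closure_upperHalfDisc_subset hw).2, fun i => ?_⟩)
    rw [norm_torusExp_apply, hcim, hw0]
    simp

theorem mainTheorem4 (n : ℕ) (p : ℕ∞) (f : Cn n → ℂ) (hf : f ∈ ApSpace p (polydisc n))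
    (ζ : torus n) :
    HolExtendableAt (polydisc n) f (ζ : Cn n) ↔ TorusHolExtendableAt (torusRestrict f) ζ := by
  obtain ⟨g, hgc, hgf⟩ := ApSpace.exists_continuousOn hf
  have htorus : ∀ z ∈ torus n, z ∈ closure (polydisc n) :=
    fun z hz => mem_closure_polydisc fun i => (hz i).le
  have hres : ∀ z : torus n, torusRestrict f z = g z :=
    fun z => extendFrom_eqOn_of_continuousOn hgc hgf (htorus z z.2)
  constructor
  · rintro ⟨r, hr, F, hF, x, hx, hFf⟩
    -- By convexity the chosen component is the whole intersection, so it accumulates at every torus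
    -- point of the ball.
    have hconn : IsPreconnected (Metric.ball (ζ : Cn n) r ∩ polydisc n) :=
      ((convex_ball _ _).inter (convex_polydisc n)).isPreconnected
    rw [hconn.connectedComponentIn hx] at hFf
    refine ⟨_, Metric.isOpen_ball, Metric.mem_ball_self hr, F, hF, fun z hz => ?_⟩
    rw [hres]
    have hmem : (z : Cn n) ∈ closure (polydisc n) := htorus z z.2
    have := mem_closure_iff_nhdsWithin_neBot.1 hmem
    have hFz : Tendsto F (𝓝[polydisc n] (z : Cn n)) (𝓝 (F z)) :=
      ((hF.continuousOn.continuousAt (Metric.isOpen_ball.mem_nhds hz)).tendsto).mono_left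
        nhdsWithin_le_nhds
    have hgz : Tendsto g (𝓝[polydisc n] (z : Cn n)) (𝓝 (g z)) :=
      ((hgc z hmem).mono subset_closure).tendsto
    refine tendsto_nhds_unique (hFz.congr' ?_) hgz
    filter_upwards [self_mem_nhdsWithin,
      nhdsWithin_le_nhds (Metric.isOpen_ball.mem_nhds hz)] with y hyP hyB
    rw [hFf ⟨hyB, hyP⟩, hgf hyP]
  · rintro ⟨U, hU, hζ, F, hF, hFf⟩
    have hev := eventually_eq_of_eq_on_torus hU hgc (hf.1.congr hgf) hF
      (fun z hz => by rw [hFf ⟨z, hz.2⟩ hz.1, hres]) ζ hζ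
    obtain ⟨r, hr, hball⟩ := Metric.eventually_nhds_iff_ball.1 (hev.and (hU.mem_nhds hζ))
    obtain ⟨x, hx⟩ := mem_closure_iff.1 (htorus ζ ζ.2) _ Metric.isOpen_ball
      (Metric.mem_ball_self hr)
    refine ⟨r, hr, F, hF.mono fun z hz => (hball z hz).2, x, hx, fun z hz => ?_⟩
    obtain ⟨hzB, hzP⟩ := connectedComponentIn_subset _ _ hz
    rw [(hball z hzB).1 hzP, hgf hzP]
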